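/- Let $\epsilon>0$, $d\ge 1$, and let $p^0\in\mathbb{R}^d$ have strictly positive entries with $\sum_{j=1}^d p^0_j=1$. The exponential mechanism $\mathcal{M}_{\mathrm{EXP}}(\cdot,\epsilon)$ takes as input a standard basis vector $x\in\{e_1,\dots,e_d\}$ of $\mathbb{R}^d$ and outputs $z\in\{e_1,\dots,e_d\}$ with probability $$\frac{\exp(\epsilon\,\mathbf{1}\{x=z\})}{e^\epsilon-1+d}.$$ For each $n$, let $X_1,\dots,X_n$ be i.i.d. $\mathrm{Multinomial}(1,p)$ random vectors, where $p$ is a probability vector that may depend on $n$. Let $\check H=\sum_{i=1}^n \mathcal{M}_{\mathrm{EXP}}(X_i,\epsilon)$ be the histogram of the outputs of the mechanism, run with independent randomness for each $i$. Put $$\check p^0=\frac{1}{e^\epsilon+d-1}\left(e^\epsilon p^0+(\mathbf{1}-p^0)\right),\qquad T_n=\sum_{j=1}^d\frac{(\check H_j-n\check p^0_j)^2}{n\check p^0_j}.$$ 1. Under the null hypothesis $\mathrm{H}_0: p=p^0$ (for every $n$), $T_n$ converges in distribution, as $n\to\infty$, to the chi-square distribution $\chi^2_{d-1}$. 2. Let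 $\Delta\in\mathbb{R}^d$ be fixed with $\sum_{j=1}^d\Delta_j=0$. Under the local alternatives $\mathrm{H}_1: p=p^0+\Delta/\sqrt n$ (for all sufficiently large $n$, so that $p$ is a probability vector), $T_n$ converges in distribution, as $n\to\infty$, to the noncentral chi-square distribution with $d-1$ degrees of freedom and noncentrality parameter $$\left(\frac{e^\epsilon-1}{e^\epsilon+d-1}\right)^2\sum_{j=1}^d\frac{\Delta_j^2}{\check p^0_j}.$$ Here $\chi^2_k$ is the law of the sum of the squares of $k$ independent standard normal variables, and the noncentral $\chi^2_k(\lambda)$ is the law of the sum of the squares of $k$ independent unit-variance normal variables whose mean vector has squared Euclidean norm $\lambda$; for $k=0$ both are the point mass at $0$. -/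

import Mathlib

open MeasureTheory ProbabilityTheory Filter

noncomputable section

/-- The chi-square distribution `χ²_k`: the law of `Z₁² + ⋯ + Z_k²` for independent standard
normal `Z₁, …, Z_k` (the Dirac mass at `0` when `k = 0`). -/
def chiSquared (k : ℕ) : Measure ℝ :=
  (Measure.pi (fun _ : Fin k ↦ gaussianReal 0 1)).map (fun z ↦ ∑ i, z i ^ 2)

/-- The noncentral chi-square distribution `χ²_k(l)` with `k` degrees of freedom and noncentrality
parameter `l ≥ 0`: the law of `Z₁² + ⋯ + Z_k²` for independent unit variance normal variables
whose vector of means has squared Euclidean norm `l`. By rotation invariance this law depends on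
the mean vector only through `l`; here the mean vector is `(√l, 0, …, 0)`. -/
def noncentralChiSquared (k : ℕ) (l : ℝ) : Measure ℝ :=
  (Measure.pi (fun i : Fin k ↦ gaussianReal (if (i : ℕ) = 0 then √l else 0) 1)).map
    (fun z ↦ ∑ i, z i ^ 2)

instance isProbabilityMeasure_chiSquared (k : ℕ) : IsProbabilityMeasure (chiSquared k) :=
  Measure.isProbabilityMeasure_map (Measurable.aemeasurable (by fun_prop))

instance isProbabilityMeasure_noncentralChiSquared (k : ℕ) (l : ℝ) :
    IsProbabilityMeasure (noncentralChiSquared k l) :=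
  Measure.isProbabilityMeasure_map (Measurable.aemeasurable (by fun_prop))

/-- The probability with which the exponential mechanism outputs `z` on input `x`:
`exp (ε q(x, z)) / (e^ε - 1 + d)` with quality score `q(x, z) = 𝟙{x = z}`.
The category `j : Fin d` stands for the standard basis vector `e_j` of `ℝ^d`. -/
def expMechanismProb {d : ℕ} (ε : ℝ) (x z : Fin d) : ℝ :=
  Real.exp (ε * (if x = z then 1 else 0)) / (Real.exp ε - 1 + d)

lemma expMechanismProb_denom_pos {d : ℕ} (ε : ℝ) (x : Fin d) :
    0 < Real.exp ε - 1 + (d : ℝ) := by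
  have h1 : (1 : ℝ) ≤ d := by exact_mod_cast x.pos
  have h2 := Real.exp_pos ε
  linarith

lemma expMechanismProb_nonneg {d : ℕ} (ε : ℝ) (x z : Fin d) : 0 ≤ expMechanismProb ε x z :=
  div_nonneg (Real.exp_pos _).le (expMechanismProb_denom_pos ε x).le

lemma sum_expMechanismProb {d : ℕ} (ε : ℝ) (x : Fin d) : ∑ z, expMechanismProb ε x z = 1 := by
  have h : ∀ z : Fin d, Real.exp (ε * (if x = z then 1 else 0)) =
      1 + (if x = z then Real.exp ε - 1 else 0) := by
    intro z
    split_ifs <;> simp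
  unfold expMechanismProb
  rw [← Finset.sum_div, div_eq_one_iff_eq (expMechanismProb_denom_pos ε x).ne']
  simp only [h, Finset.sum_add_distrib, Finset.sum_ite_eq, Finset.mem_univ, if_true]
  simp
  ring

/-- The exponential mechanism with privacy parameter `ε` (generalized randomized response):
the distribution of the private output on input `x`. -/
def expMechanism {d : ℕ} (ε : ℝ) (x : Fin d) : PMF (Fin d) :=
  PMF.ofFintype (fun z ↦ ENNReal.ofReal (expMechanismProb ε x z)) (by
    rw [← ENNReal.ofReal_sum_of_nonneg (fun z _ ↦ expMechanismProb_nonneg ε x z),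
      sum_expMechanismProb, ENNReal.ofReal_one])

/-- `Y₁, …, Y_n` are the private outputs obtained by applying the exponential mechanism, with
fresh independent randomness for each individual, to i.i.d. data `X₁, …, X_n` drawn from
`Multinomial(1, p)`. -/
structure IsExpMechanismSample {Ω : Type*} [MeasurableSpace Ω] {d n : ℕ} (ε : ℝ) (p : Fin d → ℝ)
    (X Y : Fin n → Ω → Fin d) (P : Measure Ω) : Prop where
  /-- The input-output pairs of different individuals are independent. -/
  indep : iIndepFun (fun i ω ↦ (X i ω, Y i ω)) P
  /-- Each data point has distribution `p`. -/
  law_data : ∀ i x, P.real {ω | X i ω = x} = p x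
  /-- Given the data point `x`, the output is drawn from the exponential mechanism at `x`. -/
  law_output : ∀ i x z, P.real {ω | X i ω = x ∧ Y i ω = z} =
    P.real {ω | X i ω = x} * (expMechanism ε x z).toReal

/-- The histogram `∑ i, e_{y i}` in `ℝ^d` of the entries `y₁, …, y_n`. -/
def histogram {d n : ℕ} (y : Fin n → Fin d) : Fin d → ℝ :=
  ∑ i, Pi.single (y i) (1 : ℝ)

/-- The vector `p̌ = (e^ε p + (1 - p)) / (e^ε + d - 1)`. -/
def privateProb {d : ℕ} (ε : ℝ) (p : Fin d → ℝ) (j : Fin d) : ℝ :=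
  1 / (Real.exp ε + d - 1) * (Real.exp ε * p j + (1 - p j))

/-- The statistic `∑ j, (h j - n p̌⁰ j)² / (n p̌⁰ j)` of a histogram `h` of `n` entries. -/
def expChiSquareStat {d : ℕ} (ε : ℝ) (p0 : Fin d → ℝ) (n : ℕ) (h : Fin d → ℝ) : ℝ :=
  ∑ j, (h j - n * privateProb ε p0 j) ^ 2 / (n * privateProb ε p0 j)

end

/-! ### Characteristic functions of normalised multinomial sums -/

section ChiSquareLimit

open Topology
open scoped RealInnerProductSpace

/-! The outputs are i.i.d., and their law depends affinely on `p`: moving `p0` by `Δ/√n` moves it by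
`cΔ/√n`, with `c = (e^ε - 1)/(e^ε + d - 1)`. So everything reduces to Pearson's theorem under local
alternatives (`tendstoInDistribution_pearson`) with `q = p̌⁰`, `δ = cΔ`.

For that, `exists_standardized_indicator` encodes categories as vectors `f j` in dimension `d - 1`,
of mean zero and identity covariance under `q`, such that the statistic is the squared norm of
`n^(-1/2) ∑ f (Y i)`. The characteristic function of this sum is an `n`-th power, whose limit
(`tendsto_sum_mul_exp_div_sqrt_pow`) is that of a unit-covariance Gaussian with mean `∑ δ j • f j`.
Lévy continuity and continuous mapping conclude; the null case is `Δ = 0`. -/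

lemma tendsto_nat_mul_exp_div_sqrt_sub (a : ℝ) :
    Tendsto (fun n : ℕ ↦ (n : ℂ) * (Complex.exp ((a / √n : ℝ) * Complex.I) - 1 -
      (a / √n : ℝ) * Complex.I)) atTop (𝓝 (-(a : ℂ) ^ 2 / 2)) := by
  have hinv : Tendsto (fun n : ℕ ↦ |a| / √(n : ℝ)) atTop (𝓝 0) :=
    tendsto_const_nhds.div_atTop (Real.tendsto_sqrt_atTop.comp tendsto_natCast_atTop_atTop)
  rw [tendsto_iff_norm_sub_tendsto_zero]
  have hlim : Tendsto (fun n : ℕ ↦ |a| ^ 2 * (|a| / √(n : ℝ))) atTop (𝓝 0) := by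
    simpa only [mul_zero] using hinv.const_mul (|a| ^ 2)
  refine squeeze_zero' (Eventually.of_forall fun _ ↦ norm_nonneg _) ?_ hlim
  filter_upwards [hinv.eventually (ge_mem_nhds one_pos), eventually_gt_atTop 0] with n hn hn0
  have hn' : (0 : ℝ) < n := Nat.cast_pos.2 hn0
  have hsq : √(n : ℝ) ^ 2 = n := Real.sq_sqrt hn'.le
  have hs : 0 < √(n : ℝ) := Real.sqrt_pos.2 hn'
  set x : ℂ := (a / √n : ℝ) * Complex.I with hx
  have hxnorm : ‖x‖ = |a| / √(n : ℝ) := by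
    rw [hx, norm_mul, Complex.norm_I, mul_one, Complex.norm_real, Real.norm_eq_abs, abs_div,
      abs_of_pos hs]
  have hx2 : (n : ℂ) * (x ^ 2 / 2) = -(a : ℂ) ^ 2 / 2 := by
    have hc : (n : ℂ) * ((a / √n : ℝ) : ℂ) ^ 2 = (a : ℂ) ^ 2 := by
      norm_cast
      rw [div_pow, hsq]
      field_simp
    rw [hx, mul_pow, Complex.I_sq]
    linear_combination (-1 / 2 : ℂ) * hc
  -- The cubic Taylor remainder, times `n`, is at most `n (|a|/√n)^3 = |a|^3/√n`.
  have hb := Complex.exp_bound (x := x) (hxnorm ▸ hn) (n := 3) (by norm_num)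
  simp only [Finset.sum_range_succ, Finset.sum_range_zero, Nat.factorial] at hb
  have heq : (n : ℂ) * (Complex.exp x - 1 - x) - -(a : ℂ) ^ 2 / 2 =
      n * (Complex.exp x - (0 + x ^ 0 / ((1 : ℕ) : ℂ) + x ^ 1 / (((0 + 1) * 1 : ℕ) : ℂ) +
        x ^ 2 / (((1 + 1) * ((0 + 1) * 1) : ℕ) : ℂ))) := by
    rw [← hx2]
    push_cast
    ring
  rw [heq, norm_mul, Complex.norm_natCast]
  calc (n : ℝ) * _ ≤ n * (‖x‖ ^ 3 * 1) := by
        gcongr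
        refine hb.trans ?_
        gcongr
        norm_num
    _ = |a| ^ 2 * (|a| / √(n : ℝ)) := by
        rw [hxnorm, div_pow, pow_succ (√(n : ℝ)), hsq]
        field_simp

lemma tendsto_sqrt_mul_exp_div_sqrt_sub_one (a : ℝ) :
    Tendsto (fun n : ℕ ↦ (√(n : ℝ) : ℂ) * (Complex.exp ((a / √n : ℝ) * Complex.I) - 1)) atTop
      (𝓝 (a * Complex.I)) := by
  have hinv : Tendsto (fun n : ℕ ↦ (((√(n : ℝ))⁻¹ : ℝ) : ℂ)) atTop (𝓝 0) := by
    have h : Tendsto (fun n : ℕ ↦ (√(n : ℝ))⁻¹) atTop (𝓝 0) :=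
      tendsto_inv_atTop_zero.comp (Real.tendsto_sqrt_atTop.comp tendsto_natCast_atTop_atTop)
    exact_mod_cast (Complex.continuous_ofReal.tendsto 0).comp h
  have h := (hinv.mul (tendsto_nat_mul_exp_div_sqrt_sub a)).add_const ((a : ℂ) * Complex.I)
  rw [zero_mul, zero_add] at h
  refine h.congr' ?_
  filter_upwards [eventually_gt_atTop 0] with n hn0
  have hn' : (0 : ℝ) < n := Nat.cast_pos.2 hn0
  have hs : (√(n : ℝ) : ℂ) ≠ 0 := by exact_mod_cast (Real.sqrt_pos.2 hn').ne'
  have hsq : (n : ℂ) = (√(n : ℝ) : ℂ) ^ 2 := by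
    exact_mod_cast (Real.sq_sqrt hn'.le).symm
  rw [hsq]
  push_cast
  field_simp
  ring

/-- Write the base as `1 + z_n`. The three sum conditions cancel the terms of order `n` and `√n` in
`n z_n`, which therefore converges, and `(1 + z_n)^n` tends to the exponential of its limit. -/
lemma tendsto_sum_mul_exp_div_sqrt_pow {ι : Type*} [Fintype ι] {q δ a : ι → ℝ}
    (hq : ∑ j, q j = 1) (hδ : ∑ j, δ j = 0) (hqa : ∑ j, q j * a j = 0) :
    Tendsto (fun n : ℕ ↦ (∑ j, ((q j + δ j / √n : ℝ) : ℂ) *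
      Complex.exp ((a j / √n : ℝ) * Complex.I)) ^ n) atTop
      (𝓝 (Complex.exp ((∑ j, δ j * a j : ℝ) * Complex.I - (∑ j, q j * a j ^ 2 : ℝ) / 2))) := by
  have h1 : Tendsto (fun n : ℕ ↦ ∑ j, ((q j : ℂ) *
      ((n : ℂ) * (Complex.exp ((a j / √n : ℝ) * Complex.I) - 1 - (a j / √n : ℝ) * Complex.I)) +
      (δ j : ℂ) * ((√(n : ℝ) : ℂ) * (Complex.exp ((a j / √n : ℝ) * Complex.I) - 1)))) atTop
      (𝓝 (∑ j, ((q j : ℂ) * (-(a j : ℂ) ^ 2 / 2) + (δ j : ℂ) * (a j * Complex.I)))) :=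
    tendsto_finsetSum _ fun j _ ↦ ((tendsto_nat_mul_exp_div_sqrt_sub (a j)).const_mul _).add
      ((tendsto_sqrt_mul_exp_div_sqrt_sub_one (a j)).const_mul _)
  have hlim : ∑ j, ((q j : ℂ) * (-(a j : ℂ) ^ 2 / 2) + (δ j : ℂ) * (a j * Complex.I)) =
      (∑ j, δ j * a j : ℝ) * Complex.I - (∑ j, q j * a j ^ 2 : ℝ) / 2 := by
    push_cast
    rw [Finset.sum_mul, Finset.sum_div, ← Finset.sum_sub_distrib]
    exact Finset.sum_congr rfl fun j _ ↦ by ring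
  rw [hlim] at h1
  have h2 : Tendsto (fun n : ℕ ↦ (n : ℂ) * (∑ j, ((q j + δ j / √n : ℝ) : ℂ) *
      Complex.exp ((a j / √n : ℝ) * Complex.I) - 1)) atTop
      (𝓝 ((∑ j, δ j * a j : ℝ) * Complex.I - (∑ j, q j * a j ^ 2 : ℝ) / 2)) := by
    refine h1.congr' ?_
    filter_upwards [eventually_gt_atTop 0] with n hn0
    have hn' : (0 : ℝ) < n := Nat.cast_pos.2 hn0
    have hs : (√(n : ℝ) : ℂ) ≠ 0 := by exact_mod_cast (Real.sqrt_pos.2 hn').ne'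
    have hsq : (n : ℂ) = (√(n : ℝ) : ℂ) ^ 2 := by
      exact_mod_cast (Real.sq_sqrt hn'.le).symm
    have hq' : ∑ j, (q j : ℂ) = 1 := by exact_mod_cast hq
    have hδ' : ∑ j, (δ j : ℂ) = 0 := by exact_mod_cast hδ
    have hqa' : ∑ j, (q j : ℂ) * a j = 0 := by exact_mod_cast hqa
    have hterm : ∀ j, (q j : ℂ) * ((n : ℂ) *
        (Complex.exp ((a j / √n : ℝ) * Complex.I) - 1 - (a j / √n : ℝ) * Complex.I)) +
        (δ j : ℂ) * ((√(n : ℝ) : ℂ) * (Complex.exp ((a j / √n : ℝ) * Complex.I) - 1)) =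
        n * (((q j + δ j / √n : ℝ) : ℂ) * Complex.exp ((a j / √n : ℝ) * Complex.I)) -
        n * q j - √(n : ℝ) * Complex.I * (q j * a j) - √(n : ℝ) * δ j := by
      intro j
      rw [hsq]
      push_cast
      field_simp
      ring
    simp_rw [hterm, Finset.sum_sub_distrib, ← Finset.mul_sum, hq', hδ', hqa']
    ring
  refine (Complex.tendsto_one_add_pow_exp_of_tendsto h2).congr fun n ↦ ?_
  rw [add_sub_cancel]

lemma charFun_map_inv_sqrt_smul_sum {Ω : Type*} [MeasurableSpace Ω] {P : Measure Ω}
    [IsProbabilityMeasure P] {d n : ℕ} {E : Type*} [NormedAddCommGroup E] [InnerProductSpace ℝ E]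
    [FiniteDimensional ℝ E] [MeasurableSpace E] [BorelSpace E] (f : Fin d → E) {p : Fin d → ℝ}
    {Y : Fin n → Ω → Fin d} (hY : ∀ i, Measurable (Y i)) (hind : iIndepFun Y P)
    (hlaw : ∀ i j, P.real {ω | Y i ω = j} = p j) (t : E) :
    charFun (P.map (fun ω ↦ (√(n : ℝ))⁻¹ • ∑ i, f (Y i ω))) t =
      (∑ j, (p j : ℂ) * Complex.exp ((⟪f j, t⟫ / √(n : ℝ) : ℝ) * Complex.I)) ^ n := by
  have hf : Measurable f := measurable_of_finite f
  have hfY : ∀ i, Measurable fun ω ↦ f (Y i ω) := fun i ↦ hf.comp (hY i)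
  rw [charFun_map_smul_comp (Finset.measurable_sum _ fun i _ ↦ hfY i).aemeasurable,
    iIndepFun.charFun_map_fun_sum_eq_prod (fun i ↦ (hfY i).aemeasurable)
      (hind.comp (fun _ ↦ f) fun _ ↦ hf), Finset.prod_apply]
  have hi : ∀ i, charFun (P.map fun ω ↦ f (Y i ω)) ((√(n : ℝ))⁻¹ • t) =
      ∑ j, (p j : ℂ) * Complex.exp ((⟪f j, t⟫ / √(n : ℝ) : ℝ) * Complex.I) := by
    intro i
    have hmap : P.map (fun ω ↦ f (Y i ω)) = (P.map (Y i)).map f :=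
      (Measure.map_map hf (hY i)).symm
    have := Measure.isProbabilityMeasure_map (μ := P) (hY i).aemeasurable
    rw [hmap, charFun_apply, integral_map hf.aemeasurable (by fun_prop),
      integral_fintype Integrable.of_finite]
    refine Finset.sum_congr rfl fun j _ ↦ ?_
    have hpj : (P.map (Y i)).real {j} = p j := by
      rw [map_measureReal_apply (hY i) (measurableSet_singleton j), ← hlaw i j]
      rfl
    rw [hpj, real_inner_smul_right, Complex.real_smul, inv_mul_eq_div]
  simp [hi]

/-! ### Geometry of the Pearson statistic -/

/-- Take for `f j` the projection of `e_j/√(q j)` onto the orthogonal complement of the unit vector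
`u = (√(q j))`, in coordinates of an orthonormal basis of this hyperplane. Aligning the first basis
vector with the image of `δ` gives the mean vector used in `noncentralChiSquared`. -/
lemma exists_standardized_indicator {d : ℕ} {q δ : Fin d → ℝ} (hq0 : ∀ j, 0 < q j)
    (hq : ∑ j, q j = 1) (hδ : ∑ j, δ j = 0) :
    ∃ f : Fin d → EuclideanSpace ℝ (Fin (d - 1)),
      (∀ c : Fin d → ℝ, ‖∑ j, c j • f j‖ ^ 2 = ∑ j, (c j - (∑ k, c k) * q j) ^ 2 / q j) ∧
      (∀ t, ∑ j, q j * ⟪f j, t⟫ ^ 2 = ‖t‖ ^ 2) ∧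
      ∀ i, (∑ j, δ j • f j) i = if (i : ℕ) = 0 then √(∑ j, δ j ^ 2 / q j) else 0 := by
  have hsq : ∀ j, √(q j) * √(q j) = q j := fun j ↦ Real.mul_self_sqrt (hq0 j).le
  have hsp : ∀ j, 0 < √(q j) := fun j ↦ Real.sqrt_pos.2 (hq0 j)
  obtain ⟨k, rfl⟩ : ∃ k, d = k + 1 := by
    refine Nat.exists_eq_succ_of_ne_zero ?_
    rintro rfl
    simp at hq
  simp only
  let u : EuclideanSpace ℝ (Fin (k + 1)) := WithLp.toLp 2 fun j ↦ √(q j)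
  have hu : u ≠ 0 := fun h ↦ (hsp 0).ne' (by simpa [u] using congrArg (fun x ↦ x 0) h)
  let F : Submodule ℝ (EuclideanSpace ℝ (Fin (k + 1))) := (ℝ ∙ u)ᗮ
  have hmem : ∀ x : EuclideanSpace ℝ (Fin (k + 1)), x ∈ F ↔ ∑ j, √(q j) * x j = 0 := by
    intro x
    rw [Submodule.mem_orthogonal_singleton_iff_inner_right]
    simp [u, PiLp.inner_apply, mul_comm]
  have hrank : Module.finrank ℝ F = k := by
    have : Fact (Module.finrank ℝ (EuclideanSpace ℝ (Fin (k + 1))) = k + 1) := ⟨by simp⟩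
    exact Submodule.finrank_orthogonal_span_singleton hu
  have hcomb : ∀ c : Fin (k + 1) → ℝ, ∑ j, √(q j) * ((c j - (∑ l, c l) * q j) / √(q j)) = 0 := by
    intro c
    simp_rw [fun j ↦ mul_div_cancel₀ (c j - (∑ l, c l) * q j) (hsp j).ne',
      Finset.sum_sub_distrib, ← Finset.mul_sum, hq]
    ring
  let G : (Fin (k + 1) → ℝ) → F := fun c ↦
    ⟨WithLp.toLp 2 fun j ↦ (c j - (∑ l, c l) * q j) / √(q j), (hmem _).2 (hcomb c)⟩
  have hG : ∀ c, ‖G c‖ ^ 2 = ∑ j, (c j - (∑ l, c l) * q j) ^ 2 / q j := by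
    intro c
    simp only [G, Submodule.coe_norm, EuclideanSpace.real_norm_sq_eq]
    exact Finset.sum_congr rfl fun j _ ↦ by rw [div_pow, Real.sq_sqrt (hq0 j).le]
  have hGsum : ∀ c : Fin (k + 1) → ℝ, ∑ j, c j • G (Pi.single j 1) = G c := by
    intro c
    ext l
    simp only [G, Submodule.coe_sum, Submodule.coe_smul, WithLp.ofLp_sum,
      Finset.sum_apply, smul_eq_mul, Finset.sum_pi_single', Finset.mem_univ,
      if_true, WithLp.ofLp_smul, Pi.smul_apply]
    simp_rw [← mul_div_assoc, ← Finset.sum_div, mul_sub, Finset.sum_sub_distrib, one_mul,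
      ← Finset.sum_mul, Pi.single_apply]
    simp
  have hGδ : ‖G δ‖ = √(∑ j, δ j ^ 2 / q j) := by
    rw [← Real.sqrt_sq (norm_nonneg (G δ)), hG]
    simp [hδ]
  obtain ⟨b, hb⟩ : ∃ b : OrthonormalBasis (Fin k) ℝ F,
      ∀ i, ⟪b i, G δ⟫ = if (i : ℕ) = 0 then ‖G δ‖ else 0 := by
    -- The index set is empty when `k = 0` or `G δ = 0`, so these degenerate cases need no separate
    -- basis.
    have hv : Orthonormal ℝ (({i : Fin k | (i : ℕ) = 0 ∧ G δ ≠ 0} : Set (Fin k)).domRestrict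
        fun _ ↦ ‖G δ‖⁻¹ • G δ) := by
      refine ⟨fun i ↦ ?_, fun i j hij ↦ ?_⟩
      · have h0 : ‖G δ‖ ≠ 0 := norm_ne_zero_iff.2 i.2.2
        rw [Set.domRestrict, norm_smul, norm_inv, norm_norm, inv_mul_cancel₀ h0]
      · exact absurd (Subtype.ext (Fin.ext (i.2.1.trans j.2.1.symm))) hij
    obtain ⟨b, hb⟩ := hv.exists_orthonormalBasis_extension_of_card_eq (by simp [hrank])
    refine ⟨b, fun i ↦ ?_⟩
    by_cases h0 : G δ = 0
    · simp [h0]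
    have hn : ‖G δ‖ ≠ 0 := norm_ne_zero_iff.2 h0
    split_ifs with hi
    · rw [hb i ⟨hi, h0⟩, real_inner_smul_left, real_inner_self_eq_norm_sq]
      field_simp
    · let i0 : Fin k := ⟨0, i.pos⟩
      have hGb : G δ = ‖G δ‖ • b i0 := by
        rw [hb i0 ⟨rfl, h0⟩, smul_smul, mul_inv_cancel₀ hn, one_smul]
      rw [hGb, real_inner_smul_right, b.orthonormal.2 (fun h ↦ hi (by simp [h, i0])), mul_zero]
  refine ⟨fun j ↦ b.repr (G (Pi.single j 1)), fun c ↦ ?_, fun t ↦ ?_, fun i ↦ ?_⟩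
  · simp_rw [← map_smul, ← map_sum, hGsum, LinearIsometryEquiv.norm_map, hG]
  · have ht := (hmem _).1 (b.repr.symm t).2
    rw [← LinearIsometryEquiv.norm_map b.repr.symm t, Submodule.coe_norm,
      EuclideanSpace.real_norm_sq_eq]
    refine Finset.sum_congr rfl fun j _ ↦ ?_
    have hin : ⟪b.repr (G (Pi.single j 1)), t⟫ = (b.repr.symm t).1 j / √(q j) := by
      rw [← b.repr.symm.inner_map_map, LinearIsometryEquiv.symm_apply_apply, Submodule.coe_inner]
      -- The last term sums to zero over `l`, since the vector is orthogonal to `u`.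
      have hterm : ∀ l, ((Pi.single j (1 : ℝ) : Fin (k + 1) → ℝ) l - 1 * q l) / √(q l) *
          (b.repr.symm t).1 l =
          (if l = j then (b.repr.symm t).1 l / √(q l) else 0) -
            √(q l) * (b.repr.symm t).1 l := by
        intro l
        have h1 := hsp l
        rw [Pi.single_apply]
        nth_rewrite 1 [← hsq l]
        split_ifs
        · field_simp
        · field_simp
          ring
      simp only [G, PiLp.inner_apply, RCLike.inner_apply, conj_trivial, Finset.sum_pi_single',
        Finset.mem_univ, if_true]
      simp_rw [mul_comm ((b.repr.symm t).1 _), hterm, Finset.sum_sub_distrib, ht]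
      simp
    rw [hin, div_pow, Real.sq_sqrt (hq0 j).le]
    have := hq0 j
    field_simp
  · simp_rw [← map_smul, ← map_sum, hGsum, b.repr_apply_apply, hb, hGδ]

/-! ### Pearson's theorem under local alternatives -/

lemma charFun_pi_gaussianReal_one {ι : Type*} [Fintype ι] (m t : EuclideanSpace ℝ ι) :
    charFun ((Measure.pi fun i ↦ gaussianReal (m i) 1).map (WithLp.toLp 2)) t =
      Complex.exp ((⟪m, t⟫ : ℝ) * Complex.I - ((‖t‖ ^ 2 : ℝ) : ℂ) / 2) := by
  rw [charFun_pi]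
  simp_rw [charFun_gaussianReal, ← Complex.exp_sum, EuclideanSpace.real_norm_sq_eq,
    PiLp.inner_apply]
  congr 1
  push_cast
  rw [Finset.sum_mul, Finset.sum_div, ← Finset.sum_sub_distrib]
  exact Finset.sum_congr rfl fun i _ ↦ by simp

/-- Convergence of Pearson's statistic under local alternatives. -/
theorem tendstoInDistribution_pearson {d : ℕ} {q δ : Fin d → ℝ} (hq0 : ∀ j, 0 < q j)
    (hq : ∑ j, q j = 1) (hδ : ∑ j, δ j = 0)
    {Ω : ℕ → Type*} [∀ n, MeasurableSpace (Ω n)]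
    (P : ∀ n, Measure (Ω n)) [∀ n, IsProbabilityMeasure (P n)]
    (Y : ∀ n, Fin n → Ω n → Fin d) (hY : ∀ n i, Measurable (Y n i))
    (hlaw : ∀ᶠ n : ℕ in atTop, iIndepFun (Y n) (P n) ∧
      ∀ i j, (P n).real {ω | Y n i ω = j} = q j + δ j / √(n : ℝ)) :
    TendstoInDistribution
      (fun n ω ↦ ∑ j, (histogram (fun i ↦ Y n i ω) j - n * q j) ^ 2 / (n * q j)) atTop
      (id : ℝ → ℝ) P (noncentralChiSquared (d - 1) (∑ j, δ j ^ 2 / q j)) := by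
  obtain ⟨f, hfnorm, hft, hfδ⟩ := exists_standardized_indicator hq0 hq hδ
  -- Centring: at `c = q` the norm formula vanishes.
  have hfq : ∑ j, q j • f j = 0 := by
    have h := hfnorm q
    rw [hq] at h
    simpa using h
  have hW : ∀ n : ℕ, Measurable fun ω ↦ (√(n : ℝ))⁻¹ • ∑ i, f (Y n i ω) := fun n ↦
    (measurable_const_smul _).comp
      (Finset.measurable_sum _ fun i _ ↦ (measurable_of_finite f).comp (hY n i))
  have hZ : TendstoInDistribution (fun (n : ℕ) ω ↦ (√(n : ℝ))⁻¹ • ∑ i, f (Y n i ω)) atTop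
      (WithLp.toLp 2 : (Fin (d - 1) → ℝ) → EuclideanSpace ℝ (Fin (d - 1))) P
      (Measure.pi fun i ↦ gaussianReal ((∑ j, δ j • f j) i) 1) := by
    refine ⟨fun n ↦ (hW n).aemeasurable, by fun_prop, ?_⟩
    refine ProbabilityMeasure.tendsto_iff_tendsto_charFun.2 fun t ↦ ?_
    have hqa : ∑ j, q j * ⟪f j, t⟫ = 0 := by
      simp_rw [← real_inner_smul_left, ← sum_inner, hfq, inner_zero_left]
    have hδa : ∑ j, δ j * ⟪f j, t⟫ = ⟪∑ j, δ j • f j, t⟫ := by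
      simp_rw [← real_inner_smul_left, ← sum_inner]
    have h := tendsto_sum_mul_exp_div_sqrt_pow hq hδ hqa
    rw [hδa, hft, ← charFun_pi_gaussianReal_one] at h
    refine h.congr' ?_
    filter_upwards [hlaw] with n hn
    exact (charFun_map_inv_sqrt_smul_sum f (hY n) hn.1 hn.2 t).symm
  -- The norm formula is applied to the counts; their total is `n`, so they are centred at `n q j`.
  -- At `n = 0` both sides are `0`.
  have hstat : ∀ (n : ℕ) ω, ‖(√(n : ℝ))⁻¹ • ∑ i, f (Y n i ω)‖ ^ 2 =
      ∑ j, (histogram (fun i ↦ Y n i ω) j - n * q j) ^ 2 / (n * q j) := by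
    intro n ω
    have h1 : ∑ i, f (Y n i ω) = ∑ j, histogram (fun i ↦ Y n i ω) j • f j := by
      simp_rw [histogram, Finset.sum_apply, Finset.sum_smul]
      rw [Finset.sum_comm]
      simp [Pi.single_apply]
    have h2 : ∑ j, histogram (fun i ↦ Y n i ω) j = n := by
      simp_rw [histogram, Finset.sum_apply]
      rw [Finset.sum_comm]
      simp
    rw [norm_smul, mul_pow, h1, hfnorm, h2, norm_inv, inv_pow, Real.norm_eq_abs, sq_abs,
      Real.sq_sqrt n.cast_nonneg, Finset.mul_sum]
    exact Finset.sum_congr rfl fun j _ ↦ by rw [← div_div, div_right_comm, inv_mul_eq_div,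
      div_right_comm]
  have hsq := hZ.continuous_comp (g := fun x ↦ ‖x‖ ^ 2) (by fun_prop)
  have hμ : noncentralChiSquared (d - 1) (∑ j, δ j ^ 2 / q j) =
      (Measure.pi fun i ↦ gaussianReal ((∑ j, δ j • f j) i) 1).map
        ((fun x : EuclideanSpace ℝ (Fin (d - 1)) ↦ ‖x‖ ^ 2) ∘ WithLp.toLp 2) := by
    simp_rw [noncentralChiSquared, hfδ]
    congr 1
    ext z
    simp [EuclideanSpace.real_norm_sq_eq]
  have hfun : (fun (n : ℕ) ↦ (fun x : EuclideanSpace ℝ (Fin (d - 1)) ↦ ‖x‖ ^ 2) ∘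
      fun ω ↦ (√(n : ℝ))⁻¹ • ∑ i, f (Y n i ω)) =
      fun (n : ℕ) ω ↦ ∑ j, (histogram (fun i ↦ Y n i ω) j - n * q j) ^ 2 / (n * q j) :=
    funext fun n ↦ funext fun ω ↦ hstat n ω
  rw [hfun] at hsq
  refine ⟨hsq.forall_aemeasurable, aemeasurable_id, ?_⟩
  have hlim : (⟨(noncentralChiSquared (d - 1) (∑ j, δ j ^ 2 / q j)).map id,
      Measure.isProbabilityMeasure_map aemeasurable_id⟩ : ProbabilityMeasure ℝ) =
      ⟨_, Measure.isProbabilityMeasure_map hsq.aemeasurable_limit⟩ :=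
    Subtype.ext (Measure.map_id.trans hμ)
  rw [hlim]
  exact hsq.tendsto

end ChiSquareLimit

/-! ### Law of the private outputs -/

lemma noncentralChiSquared_zero (k : ℕ) : noncentralChiSquared k 0 = chiSquared k := by
  simp [noncentralChiSquared, chiSquared]

lemma expMechanismProb_eq {d : ℕ} (ε : ℝ) (x z : Fin d) :
    expMechanismProb ε x z =
      (1 + if x = z then Real.exp ε - 1 else 0) / (Real.exp ε + d - 1) := by
  unfold expMechanismProb
  congr 1
  · split_ifs <;> simp
  · ring

lemma sum_mul_expMechanismProb {d : ℕ} (ε : ℝ) {p : Fin d → ℝ} (hp : ∑ j, p j = 1) (z : Fin d) :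
    ∑ x, p x * expMechanismProb ε x z = privateProb ε p z := by
  simp_rw [expMechanismProb_eq, ← mul_div_assoc, ← Finset.sum_div, mul_add,
    Finset.sum_add_distrib, mul_one, hp]
  simp [privateProb]
  ring

lemma IsExpMechanismSample.iIndepFun_output {Ω : Type*} [MeasurableSpace Ω] {d n : ℕ} {ε : ℝ}
    {p : Fin d → ℝ} {X Y : Fin n → Ω → Fin d} {P : Measure Ω}
    (h : IsExpMechanismSample ε p X Y P) : iIndepFun Y P :=
  h.indep.comp (fun _ ↦ Prod.snd) fun _ ↦ measurable_snd

lemma IsExpMechanismSample.law_private {Ω : Type*} [MeasurableSpace Ω] {d n : ℕ} {ε : ℝ}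
    {p : Fin d → ℝ} (hp : ∑ j, p j = 1) {X Y : Fin n → Ω → Fin d} {P : Measure Ω}
    [IsProbabilityMeasure P] (hX : ∀ i, Measurable (X i)) (hY : ∀ i, Measurable (Y i))
    (h : IsExpMechanismSample ε p X Y P) (i : Fin n) (z : Fin d) :
    P.real {ω | Y i ω = z} = privateProb ε p z := by
  have hunion : {ω | Y i ω = z} = ⋃ x, {ω | X i ω = x ∧ Y i ω = z} := by
    ext ω
    simp
  rw [hunion, measureReal_iUnion_fintype, ← sum_mul_expMechanismProb ε hp]
  · refine Finset.sum_congr rfl fun x _ ↦ ?_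
    rw [h.law_output, h.law_data, expMechanism, PMF.ofFintype_apply,
      ENNReal.toReal_ofReal (expMechanismProb_nonneg ε x z)]
  · intro x y hxy
    exact Set.disjoint_left.2 fun ω hx hy ↦ hxy (hx.1.symm.trans hy.1)
  · exact fun x ↦ (hX i (measurableSet_singleton x)).inter (hY i (measurableSet_singleton z))

lemma privateProb_pos {d : ℕ} {ε : ℝ} (hε : 0 < ε) {p : Fin d → ℝ} {j : Fin d} (hp : 0 < p j) :
    0 < privateProb ε p j := by
  have h1 := expMechanismProb_denom_pos ε j
  have h2 := Real.one_lt_exp_iff.2 hε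
  have h3 := mul_pos (sub_pos.2 h2) hp
  exact mul_pos (one_div_pos.2 (by linarith)) (by linarith)

lemma sum_privateProb {d : ℕ} (ε : ℝ) {p : Fin d → ℝ} (hp : ∑ j, p j = 1) :
    ∑ j, privateProb ε p j = 1 := by
  simp_rw [← sum_mul_expMechanismProb ε hp]
  rw [Finset.sum_comm]
  simp_rw [← Finset.mul_sum, sum_expMechanismProb, mul_one, hp]

/-- The mechanism shrinks perturbations by this slope, whose square scales the noncentrality
parameter. -/
lemma privateProb_add {d : ℕ} (ε : ℝ) (p v : Fin d → ℝ) (j : Fin d) :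
    privateProb ε (fun k ↦ p k + v k) j =
      privateProb ε p j + (Real.exp ε - 1) / (Real.exp ε + d - 1) * v j := by
  simp only [privateProb]
  ring

lemma tendstoInDistribution_expChiSquareStat {d : ℕ} {ε : ℝ} (hε : 0 < ε)
    {p0 : Fin d → ℝ} (hp0_pos : ∀ j, 0 < p0 j) (hp0_sum : ∑ j, p0 j = 1)
    {Ω : ℕ → Type*} [∀ n, MeasurableSpace (Ω n)]
    (P : ∀ n, Measure (Ω n)) [∀ n, IsProbabilityMeasure (P n)]
    (X Y : ∀ n, Fin n → Ω n → Fin d)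
    (hX : ∀ n i, Measurable (X n i)) (hY : ∀ n i, Measurable (Y n i))
    {Δ : Fin d → ℝ} (hΔ : ∑ j, Δ j = 0)
    (h : ∀ᶠ n : ℕ in atTop,
      IsExpMechanismSample ε (fun j ↦ p0 j + Δ j / √(n : ℝ)) (X n) (Y n) (P n)) :
    TendstoInDistribution
      (fun n ω ↦ expChiSquareStat ε p0 n (histogram (fun i ↦ Y n i ω))) atTop
      (id : ℝ → ℝ) P
      (noncentralChiSquared (d - 1)
        (((Real.exp ε - 1) / (Real.exp ε + d - 1)) ^ 2 *
          ∑ j, Δ j ^ 2 / privateProb ε p0 j)) := by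
  have hl : ((Real.exp ε - 1) / (Real.exp ε + d - 1)) ^ 2 * ∑ j, Δ j ^ 2 / privateProb ε p0 j =
      ∑ j, ((Real.exp ε - 1) / (Real.exp ε + d - 1) * Δ j) ^ 2 / privateProb ε p0 j := by
    rw [Finset.mul_sum]
    exact Finset.sum_congr rfl fun j _ ↦ by rw [mul_pow, mul_div_assoc]
  simp_rw [hl]
  refine tendstoInDistribution_pearson (fun j ↦ privateProb_pos hε (hp0_pos j))
    (sum_privateProb ε hp0_sum) (by rw [← Finset.mul_sum, hΔ, mul_zero]) P Y hY ?_
  filter_upwards [h] with n hn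
  refine ⟨hn.iIndepFun_output, fun i j ↦ ?_⟩
  have hsum : ∑ j, (p0 j + Δ j / √(n : ℝ)) = 1 := by
    rw [Finset.sum_add_distrib, ← Finset.sum_div, hΔ, hp0_sum, zero_div, add_zero]
  rw [hn.law_private hsum (hX n) (hY n), privateProb_add, mul_div_assoc]

theorem mainTheorem1 {d : ℕ} {ε : ℝ} (hε : 0 < ε)
    {p0 : Fin d → ℝ} (hp0_pos : ∀ j, 0 < p0 j) (hp0_sum : ∑ j, p0 j = 1)
    {Ω : ℕ → Type*} [∀ n, MeasurableSpace (Ω n)]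
    (P : ∀ n, Measure (Ω n)) [∀ n, IsProbabilityMeasure (P n)]
    (X Y : ∀ n, Fin n → Ω n → Fin d)
    (hX : ∀ n i, Measurable (X n i)) (hY : ∀ n i, Measurable (Y n i)) :
    ((∀ n, IsExpMechanismSample ε p0 (X n) (Y n) (P n)) →
      TendstoInDistribution
        (fun n ω ↦ expChiSquareStat ε p0 n (histogram (fun i ↦ Y n i ω))) atTop
        (id : ℝ → ℝ) P (chiSquared (d - 1))) ∧
    (∀ Δ : Fin d → ℝ, ∑ j, Δ j = 0 →
      (∀ᶠ n : ℕ in atTop,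
        IsExpMechanismSample ε (fun j ↦ p0 j + Δ j / √(n : ℝ)) (X n) (Y n) (P n)) →
      TendstoInDistribution
        (fun n ω ↦ expChiSquareStat ε p0 n (histogram (fun i ↦ Y n i ω))) atTop
        (id : ℝ → ℝ) P
        (noncentralChiSquared (d - 1)
          (((Real.exp ε - 1) / (Real.exp ε + d - 1)) ^ 2 *
            ∑ j, Δ j ^ 2 / privateProb ε p0 j))) := by
  refine ⟨fun h ↦ ?_, fun Δ hΔ h ↦
    tendstoInDistribution_expChiSquareStat hε hp0_pos hp0_sum P X Y hX hY hΔ h⟩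
  have h0 := tendstoInDistribution_expChiSquareStat (Δ := 0) hε hp0_pos hp0_sum P X Y hX hY
    (by simp) (Eventually.of_forall fun n ↦ by simpa using h n)
  simpa [noncentralChiSquared_zero] using h0
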